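/- All hypergraphs are finite, with nonempty hyperedges. For a hypergraph $\mathcal H$, the general Kneser graph $\mathrm{KG}(\mathcal H)$ has the hyperedges of $\mathcal H$ as vertices, two of them being adjacent if they are disjoint. For $X\in\{-1,0,+1\}^N$ let $alt(X)$ be the length of a longest subsequence of nonzero terms of $X$ in which any two consecutive terms are different (so $alt(0,\dots,0)=0$). For a hypergraph $\mathcal H$ with $N$ vertices and a linear ordering $\sigma=(\sigma(1),\dots,\sigma(N))$ of $V(\mathcal H)$, put $X^{\pm}_\sigma=\{\sigma(j): x_j=\pm1\}$, and let $alt_\sigma(\mathcal H)$ be the largest value of $alt(X)$ over all $X\in\{-1,0,+1\}^N$ such that neither $X^+_\sigma$ nor $X^-_\sigma$ contains a hyperedge of $\mathcal H$. Let $alt(\mathcal H)=\min_\sigma alt_\sigma(\mathcal H)$. The altermatic number of a graph $G$ is $$\zeta(G)=\max_{\mathcal H}\left\{|V(\mathcal H)|-alt(\mathcal H)\right\},$$ where $\mathcal H$ runs over all hypergraphs such that $\mathrm{KG}(\mathcal H)$ and $G$ are homomorphically equivalent, i.e. there are graph homomorphisms $\mathrm{KG}(\mathcal H)\to G$ and $G\to\mathrm{KG}(\mathcal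 H)$. For a positive integer $r$, let $\mathrm{KG}(G,rK_2)$ be the graph whose vertices are the subgraphs of $G$ isomorphic to $rK_2$ (the graph consisting of $r$ pairwise disjoint edges), two of them being adjacent if they are edge-disjoint. **Corollary.** Let $m,n,r$ be positive integers with $m\ge n\ge r$. If $m$ is even, then the maximum defining $\zeta(\mathrm{KG}(K_{m,n},rK_2))$ exists, and $$\chi(\mathrm{KG}(K_{m,n},rK_2))=\zeta(\mathrm{KG}(K_{m,n},rK_2))=m(n-r+1).$$ -/

import Mathlib

open scoped Classical in
/-- The alternation number `alt(X)` of a sign vector `X`: the length of a longest alternating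
subsequence of nonzero terms of `X`. A subsequence is given by its set `s` of positions, and two
positions of `s` are consecutive in it if no position of `s` lies strictly between them. -/
noncomputable def alternationNumber {N : ℕ} (X : Fin N → SignType) : ℕ :=
  (Finset.univ.filter fun s : Finset (Fin N) =>
    (∀ i ∈ s, X i ≠ 0) ∧
      ∀ i ∈ s, ∀ j ∈ s, i < j → (∀ k ∈ s, ¬ (i < k ∧ k < j)) → X i ≠ X j).sup Finset.card

namespace Hypergraph

variable {α : Type*}

/-- The vertices of `H` that have the sign `ε` under the sign vector `X`, where the `i`-th entry
of `X` belongs to the `i`-th vertex in the ordering `σ`. For `ε = 1` and `ε = -1` these are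
the sets `X⁺_σ` and `X⁻_σ`. -/
def signClass (H : Hypergraph α) {N : ℕ} (σ : Fin N ≃ H.vertexSet) (X : Fin N → SignType)
    (ε : SignType) : Set α :=
  {v | ∃ i, X i = ε ∧ (σ i : α) = v}

open scoped Classical in
/-- `alt_σ(H)`: the largest `alt(X)` over the sign vectors `X` such that neither `X⁺_σ` nor
`X⁻_σ` contains a hyperedge of `H`. -/
noncomputable def altOrdering (H : Hypergraph α) {N : ℕ} (σ : Fin N ≃ H.vertexSet) : ℕ :=
  (Finset.univ.filter fun X : Fin N → SignType =>
    ∀ e ∈ H.edgeSet, ¬ e ⊆ H.signClass σ X 1 ∧ ¬ e ⊆ H.signClass σ X (-1)).sup alternationNumber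

/-- `alt(H)`: the minimum of `alt_σ(H)` over all linear orderings `σ` of the (finite) vertex
set. -/
noncomputable def alt (H : Hypergraph α) : ℕ :=
  ⨅ σ : Fin H.vertexSet.ncard ≃ H.vertexSet, H.altOrdering σ

/-- The general Kneser graph `KG(H)`: its vertices are the hyperedges of `H`, and two of them are
adjacent if they are disjoint. -/
def kneserGraph (H : Hypergraph α) : SimpleGraph H.edgeSet where
  Adj e f := e ≠ f ∧ Disjoint (e : Set α) (f : Set α)
  symm := ⟨fun _ _ h => ⟨h.1.symm, h.2.symm⟩⟩
  loopless := ⟨fun _ h => h.1 rfl⟩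

end Hypergraph

namespace SimpleGraph

variable {V W : Type*}

/-- The values `|V(H)| - alt(H)` over all finite hypergraphs `H` with nonempty hyperedges whose
general Kneser graph is homomorphically equivalent to `G`. -/
def altermaticValues (G : SimpleGraph V) : Set ℕ :=
  {k | ∃ (α : Type) (H : Hypergraph α), H.vertexSet.Finite ∧ ∅ ∉ H.edgeSet ∧
    Nonempty (H.kneserGraph →g G) ∧ Nonempty (G →g H.kneserGraph) ∧
    k = H.vertexSet.ncard - H.alt}

/-- The altermatic number `ζ(G)`, the maximum of `altermaticValues G`. -/
noncomputable def altermaticNumber (G : SimpleGraph V) : ℕ :=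
  sSup G.altermaticValues

/-- The general Kneser graph `KG(G, F)`: its vertices are the subgraphs of `G` isomorphic to `F`,
and two of them are adjacent if they are edge-disjoint. -/
def kneserGraphOf (G : SimpleGraph V) (F : SimpleGraph W) :
    SimpleGraph {K : G.Subgraph // Nonempty (F ≃g K.coe)} where
  Adj K L := K ≠ L ∧ Disjoint K.1.edgeSet L.1.edgeSet
  symm := ⟨fun _ _ h => ⟨h.1.symm, h.2.symm⟩⟩
  loopless := ⟨fun _ h => h.1 rfl⟩

/-- The graph `rK₂`, consisting of `r` pairwise disjoint edges. -/
def matchingGraph (r : ℕ) : SimpleGraph (Fin r × Fin 2) where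
  Adj p q := p.1 = q.1 ∧ p.2 ≠ q.2
  symm := ⟨fun _ _ h => ⟨h.1.symm, h.2.symm⟩⟩
  loopless := ⟨fun _ h => h.2 rfl⟩

end SimpleGraph

/-!
The upper bound for the chromatic number is elementary: a matching with `r` edges has an edge that
avoids any given `r - 1` vertices of the smaller part, and this edge can serve as its colour
(`MatchingKneser.colorable`).

The lower bound comes from the inequality `|V(H)| - alt(H) ≤ χ(KG(H))`
(`Hypergraph.ncard_sub_alt_le`), which also shows that no altermatic value exceeds the chromatic
number. Given an ordering and a colouring, each nonzero sign vector gets a label and a sign: its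
alternation number and leading sign if its sign classes contain no hyperedge, and otherwise the
largest colour of a hyperedge in a sign class together with the sign of that class. Labels
increase weakly along chains of sign vectors, and the sign can only change where the label does.
So it suffices that every odd sign function alternates along some maximal chain
(`AlternatingChains.exists_alternating_chain`). This is a form of Tucker's lemma: modulo 2, the
number of such chains is the value of an alternating cochain at the fundamental cycle of the
octahedral sphere, and it does not change if the dimension is lowered by one, because the
coboundary of the indicator of alternation is its symmetrization.

It remains to find a hypergraph whose Kneser graph is homomorphically equivalent to `KG(K_{m,n},
rK₂)` and for which `|V| - alt` is at least `m * (n - r + 1)`. As `m` is even, `K_{m,n}` splits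
into `m / 2` trails with `2 * n` edges, each of them a path or, if `m = n`, a Hamiltonian cycle;
edges of a trail whose positions are not cyclic neighbours are disjoint. Any `2 * r` alternating
terms on one trail contain a matching with `r` edges in *each* sign. If `m = n` and `r ≥ 2`, then
`2 * r - 1` terms need not contain one in either sign, since the first and the last edge of the
trail meet. For this reason the hypergraph of all matchings with `r` edges does not suffice in
general; it fails for `m = n = r = 2`. The remedy is a tail of `4 * n` new vertices after each
trail, every other one of which counts. A set of vertices claims an edge if it contains the edge
and a tail vertex of its trail that counts, or if it contains all tail vertices of its trail that
count; disjoint sets never claim the same edge (`MatchingKneser.not_claims_of_disjoint`). The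
hyperedges are the sets that claim a matching with `r` edges. An alternation with more than `2 *
(r - 1) + 4 * n` terms in a block has `2 * r` terms on the trail, and then the sign class of any
term at a tail vertex that counts contains a hyperedge; or it uses the whole tail, and then all
tail vertices that count have the same sign (`MatchingKneser.exists_claims_of_isAlternation`).
-/

/-! ### Alternating chains of sign vectors -/

namespace AlternatingChains

section Operators

variable {α : Type*}

/-- The simplicial coboundary modulo 2, for cochains on ordered simplices given by lists of
vertices: the sum of `a` over all lists that arise by deleting one entry. The empty list is
the simplex of dimension `-1`, so that the complex is the augmented one. -/
def coboundary (a : List α → ZMod 2) : List α → ZMod 2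
  | [] => 0
  | x :: l => a l + coboundary (fun m => a (x :: m)) l

/-- The dual of the prism operator from the identity to `τ`, completed by the cone whose apex is
`τ p`: for `l = [x₁, …, xₖ]` and `x₀ = p` it is the sum of the values of `a` at the lists
`[x₁, …, xᵢ, τ xᵢ, …, τ xₖ]` for `0 ≤ i ≤ k`. -/
def prism (τ : α → α) (a : List α → ZMod 2) (p : α) : List α → ZMod 2
  | [] => a [τ p]
  | x :: l => a (τ p :: τ x :: l.map τ) + prism τ (fun m => a (x :: m)) x l

theorem coboundary_add (a b : List α → ZMod 2) (l : List α) :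
    coboundary (fun m => a m + b m) l = coboundary a l + coboundary b l := by
  induction l generalizing a b with
  | nil => simp [coboundary]
  | cons x l ih => simp only [coboundary, ih]; ring

theorem prism_add (τ : α → α) (a b : List α → ZMod 2) (p : α) (l : List α) :
    prism τ (fun m => a m + b m) p l = prism τ a p l + prism τ b p l := by
  induction l generalizing a b p with
  | nil => simp [prism]
  | cons x l ih => simp only [prism, ih]; ring

theorem coboundary_map (τ : α → α) (a : List α → ZMod 2) (l : List α) :
    coboundary (fun m => a (m.map τ)) l = coboundary a (l.map τ) := by
  induction l generalizing a with
  | nil => simp [coboundary]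
  | cons x l ih =>
    simp only [coboundary, List.map_cons]
    rw [← ih (fun m => a (τ x :: m))]

/-- Only the first summand of `prism` depends on `p`. -/
theorem prism_add_prism (τ : α → α) (a : List α → ZMod 2) (p q : α) (l : List α) :
    prism τ a p l + prism τ a q l = a (τ p :: l.map τ) + a (τ q :: l.map τ) := by
  cases l with
  | nil => simp [prism]
  | cons x l =>
    simp only [prism, List.map_cons]
    linear_combination CharTwo.add_self_eq_zero (prism τ (fun m => a (x :: m)) x l)

/-- The prism operator is a chain homotopy between the identity and zero. -/
theorem prism_coboundary (τ : α → α) (a : List α → ZMod 2) (p : α) (l : List α) :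
    prism τ (coboundary a) p l = a l + coboundary (prism τ a p) l := by
  induction l generalizing a p with
  | nil => simp [prism, coboundary]
  | cons x l ih =>
    have h₁ : prism τ (fun m => coboundary a (x :: m)) x l =
        prism τ a x l + (a (x :: l) + coboundary (prism τ (fun m => a (x :: m)) x) l) := by
      exact (prism_add τ a (coboundary fun m => a (x :: m)) x l).trans (congrArg _ (ih _ x))
    have h₂ : coboundary (fun m => prism τ a p (x :: m)) l =
        coboundary (fun m => a (τ p :: τ x :: m)) (l.map τ) +
          coboundary (prism τ (fun m => a (x :: m)) x) l := by
      rw [← coboundary_map]; exact coboundary_add _ _ l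
    rw [prism, h₁, show coboundary (prism τ a p) (x :: l) = prism τ a p l +
      coboundary (fun m => prism τ a p (x :: m)) l from rfl, h₂]
    simp only [coboundary]
    linear_combination prism_add_prism τ a p x l +
      CharTwo.add_self_eq_zero (a (τ x :: l.map τ)) + CharTwo.add_self_eq_zero (a (τ p :: l.map τ)) -
      CharTwo.add_self_eq_zero (prism τ a p l)

/-- `prism τ a p l` only involves values of `a` at chains. -/
theorem prism_eq_zero {R : α → α → Prop} (hR : ∀ x y z, R x y → R y z → R x z) {S T : α → Prop}
    {τ : α → α} (hST : ∀ x, S x → T x ∧ T (τ x) ∧ R x (τ x))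
    (hτ : ∀ x y, R x y → R (τ x) (τ y)) {a : List α → ZMod 2} {p : α} {l : List α}
    (hp : T (τ p)) (hpτ : R p (τ p))
    (hl : (p :: l).Pairwise R) (hS : ∀ x ∈ l, S x)
    (ha : ∀ l', l'.length = l.length + 1 → l'.Pairwise R → (∀ y ∈ l', T y ∧ R p y) → a l' = 0) :
    prism τ a p l = 0 := by
  induction l generalizing a p with
  | nil => exact ha _ rfl (by simp) (by simp [hp, hpτ])
  | cons x l ih =>
    have hpx : R p x := (List.pairwise_cons.1 hl).1 x (by simp)
    have hxl := (List.pairwise_cons.1 hl).2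
    have hSx := hST x (hS x (by simp))
    rw [prism, ha, ih hSx.2.1 hSx.2.2 hxl (fun y hy => hS y (by simp [hy])), add_zero]
    · intro l' hlen hpw hT
      refine ha _ (by simp [hlen]) (List.pairwise_cons.2 ⟨fun y hy => (hT y hy).2, hpw⟩) ?_
      intro y hy
      rcases List.mem_cons.1 hy with rfl | hy
      · exact ⟨hSx.1, hpx⟩
      · exact ⟨(hT y hy).1, hR _ _ _ hpx (hT y hy).2⟩
    · simp
    · have := List.Pairwise.map τ hτ hl
      simpa using this
    · have h : ∀ y ∈ p :: x :: l, T (τ y) ∧ R p (τ y) := by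
        intro y hy
        rcases List.mem_cons.1 hy with rfl | hy
        · exact ⟨hp, hpτ⟩
        · have := hST y (hS y hy)
          exact ⟨this.2.1, hR _ _ _ ((List.pairwise_cons.1 hl).1 y hy) this.2.2⟩
      intro y hy
      have hy' : y ∈ (p :: x :: l).map τ := by simpa using hy
      obtain ⟨z, hz, rfl⟩ := List.mem_map.1 hy'
      exact h z hz

/-- The indicator function of the lists along which the values of `s` alternate, starting
with `b`. -/
def alternating (s : α → Bool) (b : Bool) : List α → ZMod 2
  | [] => 1
  | x :: l => if s x = b then alternating s (!b) l else 0

/-- A list has an odd number of alternating faces that start with `b` exactly if it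
alternates. -/
theorem coboundary_alternating (s : α → Bool) (b : Bool) (l : List α) :
    coboundary (alternating s b) l = alternating s b l + alternating s (!b) l := by
  induction l generalizing b with
  | nil => rw [coboundary, alternating, alternating, CharTwo.add_self_eq_zero]
  | cons x l ih =>
    by_cases hx : s x = b
    · simp only [coboundary, alternating, hx, if_true]
      rw [show (fun m => alternating s (!b) m) = alternating s (!b) from rfl, ih (!b), Bool.not_not]
      rw [if_neg (by cases b <;> simp), add_zero, add_left_comm, CharTwo.add_self_eq_zero, add_zero]
    · have h0 : ∀ l : List α, coboundary (fun _ => 0) l = 0 := by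
        intro l; induction l with
        | nil => rfl
        | cons x l ih => simp [coboundary, ih]
      have hx' : s x = !b := by cases b <;> simpa using hx
      simp [coboundary, alternating, hx', h0]

theorem isChain_of_alternating_ne_zero {s : α → Bool} {b : Bool} {l : List α}
    (h : alternating s b l ≠ 0) : l.IsChain (fun x y => s x ≠ s y) := by
  induction l generalizing b with
  | nil => simp
  | cons x l ih =>
    rw [alternating] at h
    split_ifs at h with hx
    · cases l with
      | nil => simp
      | cons y l =>
        refine List.isChain_cons_cons.2 ⟨?_, ih h⟩
        rw [alternating] at h
        split_ifs at h with hy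
        · rw [hx, hy]; cases b <;> simp
        · exact absurd rfl h
    · exact absurd rfl h

end Operators

/-- The order of the sign vectors: `Y` arises from `X` by giving signs to some zero entries. -/
def Extends {ι : Type*} (X Y : ι → SignType) : Prop :=
  ∀ i, X i = 0 ∨ X i = Y i

theorem Extends.trans {ι : Type*} {X Y Z : ι → SignType} (h : Extends X Y) (h' : Extends Y Z) :
    Extends X Z := by
  intro i
  rcases h i with h | h
  · exact Or.inl h
  · rw [h]; exact h' i

/-- Evaluation of a cochain at the fundamental cycle modulo 2 of the barycentric subdivision of
the boundary of the `k`-dimensional cross-polytope, whose vertices are the nonzero sign vectors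
supported on the first `k` coordinates. Of the sphere with `k + 1` coordinates, one hemisphere is
the prism over the sphere with `k` coordinates along `X ↦ X + eₖ`, capped by the cone with apex
`eₖ`, and the other one is its antipode. -/
def sphere : ℕ → (List (ℕ → SignType) → ZMod 2) → ZMod 2
  | 0, a => a []
  | k + 1, a => sphere k (prism (fun X => Function.update X k 1) a 0) +
      sphere k (prism (fun X => Function.update X k 1) (fun l => a (l.map fun X => -X)) 0)

theorem sphere_add (k : ℕ) (a b : List (ℕ → SignType) → ZMod 2) :
    sphere k (fun l => a l + b l) = sphere k a + sphere k b := by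
  induction k generalizing a b with
  | zero => rfl
  | succ k ih =>
    simp only [sphere]
    rw [show prism (fun X => Function.update X k 1) (fun l => a l + b l) (0 : ℕ → SignType) =
      fun l => prism (fun X => Function.update X k 1) a 0 l +
        prism (fun X => Function.update X k 1) b 0 l from funext fun l => prism_add _ _ _ _ _,
      show prism (fun X => Function.update X k 1)
        (fun l => a (l.map fun X => -X) + b (l.map fun X => -X)) (0 : ℕ → SignType) =
      fun l => prism (fun X => Function.update X k 1) (fun l => a (l.map fun X => -X)) 0 l +
        prism (fun X => Function.update X k 1) (fun l => b (l.map fun X => -X)) 0 l from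
          funext fun l => prism_add _ (fun l => a (l.map fun X => -X)) _ _ _, ih, ih]
    ring

theorem map_neg_map_neg (l : List (ℕ → SignType)) :
    (l.map fun X => -X).map (fun X => -X) = l := by
  rw [List.map_map]
  convert List.map_id l
  funext X
  simp

theorem sphere_neg (k : ℕ) (a : List (ℕ → SignType) → ZMod 2) :
    sphere k (fun l => a (l.map fun X => -X)) = sphere k a := by
  cases k with
  | zero => rfl
  | succ k => simp only [sphere, map_neg_map_neg]; ring

theorem sphere_prism_coboundary {k : ℕ} (h : ∀ b, sphere k (coboundary b) = 0)
    (a : List (ℕ → SignType) → ZMod 2) (τ : (ℕ → SignType) → ℕ → SignType) :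
    sphere k (prism τ (coboundary a) 0) = sphere k a := by
  rw [show prism τ (coboundary a) 0 = fun l => a l + coboundary (prism τ a 0) l from
    funext fun l => prism_coboundary _ _ _ _, sphere_add, h, add_zero]

/-- The fundamental cycle is a cycle. -/
theorem sphere_coboundary (k : ℕ) (a : List (ℕ → SignType) → ZMod 2) :
    sphere k (coboundary a) = 0 := by
  induction k generalizing a with
  | zero => rfl
  | succ k ih =>
    rw [sphere, sphere_prism_coboundary ih,
      show (fun l => coboundary a (l.map fun X => -X)) =
        coboundary (fun l => a (l.map fun X => -X)) from
          funext fun l => (coboundary_map _ _ _).symm,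
      sphere_prism_coboundary ih, sphere_neg, CharTwo.add_self_eq_zero]

theorem neg_signs_ne_zero {ι : Type*} {X : ι → SignType} (h : X ≠ 0) : -X ≠ 0 := by
  intro h'
  refine h (funext fun i => ?_)
  have h0 : -X i = 0 := congrFun h' i
  change X i = 0
  revert h0
  cases X i <;> decide

/-- The lists that occur in the fundamental cycle: the chains of `k` nonzero sign vectors that are
supported on the first `k` coordinates. -/
def IsFacet (k : ℕ) (l : List (ℕ → SignType)) : Prop :=
  l.length = k ∧ l.Pairwise Extends ∧ ∀ X ∈ l, X ≠ 0 ∧ ∀ i, k ≤ i → X i = 0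

theorem IsFacet.map_neg {k : ℕ} {l : List (ℕ → SignType)} (h : IsFacet k l) :
    IsFacet k (l.map fun X => -X) := by
  refine ⟨by simp [h.1], h.2.1.map _ fun X Y h i => ?_, ?_⟩
  · rcases h i with h | h
    · exact Or.inl (by simp [h])
    · exact Or.inr (by simp [h])
  · intro X hX
    obtain ⟨Y, hY, rfl⟩ := List.mem_map.1 hX
    exact ⟨neg_signs_ne_zero (h.2.2 Y hY).1, fun i hi => by simp [(h.2.2 Y hY).2 i hi]⟩

/-- `sphere k` only involves values at facets. The second part says the same about the hemisphere
in one more coordinate. -/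
theorem sphere_eq_zero_and {k : ℕ} :
    (∀ a : List (ℕ → SignType) → ZMod 2, (∀ l, IsFacet k l → a l = 0) → sphere k a = 0) ∧
    ∀ a : List (ℕ → SignType) → ZMod 2, (∀ l, IsFacet (k + 1) l → a l = 0) →
      sphere k (prism (fun X => Function.update X k 1) a 0) = 0 := by
  have key : ∀ k, (∀ a : List (ℕ → SignType) → ZMod 2, (∀ l, IsFacet k l → a l = 0) →
      sphere k a = 0) → ∀ a : List (ℕ → SignType) → ZMod 2, (∀ l, IsFacet (k + 1) l → a l = 0) →
      sphere k (prism (fun X => Function.update X k 1) a 0) = 0 := by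
    intro k ih a ha
    refine ih _ fun l ⟨hlen, hpw, hl⟩ => ?_
    refine prism_eq_zero (R := Extends) (S := fun X => X ≠ 0 ∧ ∀ i, k ≤ i → X i = 0)
      (T := fun X => X ≠ 0 ∧ ∀ i, k + 1 ≤ i → X i = 0) (fun _ _ _ => Extends.trans) ?_ ?_ ?_ ?_ ?_
      hl (fun l' hlen' hpw' hl' => ha l' ⟨by omega, hpw', fun X hX => (hl' X hX).1⟩)
    · rintro X ⟨h0, hX⟩
      refine ⟨⟨h0, fun i hi => hX i (by omega)⟩, ⟨fun h => ?_, fun i hi => ?_⟩, fun i => ?_⟩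
      · simpa using congrFun h k
      · rw [Function.update_of_ne (by omega), hX i (by omega)]
      · by_cases hi : i = k
        · subst hi; exact Or.inl (hX i le_rfl)
        · rw [Function.update_of_ne hi]; exact Or.inr rfl
    · intro X Y h i
      by_cases hi : i = k
      · subst hi; simp
      · rw [Function.update_of_ne hi, Function.update_of_ne hi]; exact h i
    · refine ⟨fun h => by simpa using congrFun h k, fun i hi => ?_⟩
      rw [Function.update_of_ne (by omega)]; rfl
    · exact fun i => Or.inl rfl
    · exact List.pairwise_cons.2 ⟨fun X _ i => Or.inl rfl, hpw⟩
  refine (fun h => ⟨h, key k h⟩) ?_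
  induction k with
  | zero => exact fun a ha => ha [] ⟨rfl, by simp, by simp⟩
  | succ k ih =>
    intro a ha
    rw [sphere, key k ih a ha, key k ih _ fun l hl => ha _ hl.map_neg, add_zero]

/-- The number of facets along which an odd function alternates is odd. -/
theorem sphere_alternating {N : ℕ} {s : (ℕ → SignType) → Bool}
    (hs : ∀ X, X ≠ 0 → (∀ i, N ≤ i → X i = 0) → s (-X) = !s X) {k : ℕ} (hk : k ≤ N) (b : Bool) :
    sphere k (alternating s b) = 1 := by
  induction k with
  | zero => rfl
  | succ k ih =>
    have hneg : ∀ l : List (ℕ → SignType), (∀ X ∈ l, X ≠ 0 ∧ ∀ i, k + 1 ≤ i → X i = 0) → ∀ b,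
        alternating s b (l.map fun X => -X) = alternating s (!b) l := by
      intro l
      induction l with
      | nil => intros; rfl
      | cons X l ih =>
        intro hl b
        have hX := hl X (by simp)
        rw [List.map_cons, alternating, alternating, ih (fun Y hY => hl Y (by simp [hY])),
          hs X hX.1 fun i hi => hX.2 i (by omega)]
        cases s X <;> cases b <;> simp
    have h₁ := sphere_eq_zero_and.2
      (fun l => alternating s b (l.map fun X => -X) + alternating s (!b) l)
      fun l hl => by rw [hneg l hl.2.2, CharTwo.add_self_eq_zero]
    have h₂ := sphere_prism_coboundary (sphere_coboundary k) (alternating s b)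
      (fun X => Function.update X k 1)
    rw [show prism (fun X => Function.update X k 1) _ (0 : ℕ → SignType) = _ from
      funext fun l => prism_add _ (fun l => alternating s b (l.map fun X => -X))
        (alternating s (!b)) _ _, sphere_add] at h₁
    rw [show coboundary (alternating s b) = fun l => alternating s b l + alternating s (!b) l from
      funext (coboundary_alternating s b), show prism (fun X => Function.update X k 1) _
        (0 : ℕ → SignType) = _ from funext fun l => prism_add _ (alternating s b)
        (alternating s (!b)) _ _, sphere_add, ih (by omega)] at h₂
    rw [sphere]
    linear_combination h₂ + h₁ - CharTwo.add_self_eq_zero (sphere k (prism _ (alternating s (!b)) 0))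

/-- Tucker's lemma for the octahedral sphere, in the form of an alternating chain: an odd Boolean
function on the nonzero sign vectors alternates along some maximal chain. -/
theorem exists_alternating_chain {N : ℕ} {s : (Fin N → SignType) → Bool}
    (hs : ∀ X, X ≠ 0 → s (-X) = !s X) :
    ∃ l : List (Fin N → SignType), l.length = N ∧ l.Pairwise Extends ∧ (∀ X ∈ l, X ≠ 0) ∧
      l.IsChain fun X Y => s X ≠ s Y := by
  let res : (ℕ → SignType) → Fin N → SignType := fun X i => X i
  have hres : ∀ X : ℕ → SignType, X ≠ 0 → (∀ i, N ≤ i → X i = 0) → res X ≠ 0 := by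
    intro X h0 hX h
    refine h0 (funext fun i => ?_)
    by_cases hi : i < N
    · exact congrFun h ⟨i, hi⟩
    · exact hX i (by omega)
  have h1 := sphere_alternating (s := fun X => s (res X)) (N := N)
    (fun X h0 hX => hs (res X) (hres X h0 hX)) le_rfl true
  have h2 : ∃ l, IsFacet N l ∧ alternating (fun X => s (res X)) true l ≠ 0 := by
    by_contra! h
    rw [sphere_eq_zero_and.1 _ h] at h1
    exact zero_ne_one h1
  obtain ⟨l, ⟨hlen, hpw, hl⟩, halt⟩ := h2
  refine ⟨l.map res, by simp [hlen], hpw.map _ fun X Y h i => h i, ?_, ?_⟩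
  · intro X hX
    obtain ⟨Y, hY, rfl⟩ := List.mem_map.1 hX
    exact hres Y (hl Y hY).1 (hl Y hY).2
  · rw [List.isChain_map]
    exact isChain_of_alternating_ne_zero halt

/-- A chain of length `N` whose signs `s` alternate meets `N` values of a monotone function `v`,
if `s` is constant along chains on which `v` is. -/
theorem le_of_odd_labelling {N M : ℕ} {s : (Fin N → SignType) → Bool} {v : (Fin N → SignType) → ℕ}
    (hs : ∀ X, X ≠ 0 → s (-X) = !s X) (hv : ∀ X, X ≠ 0 → v X ∈ Finset.Icc 1 M)
    (hmono : ∀ X Y, X ≠ 0 → Extends X Y → v X ≤ v Y)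
    (hsv : ∀ X Y, X ≠ 0 → Extends X Y → v X = v Y → s X = s Y) : N ≤ M := by
  obtain ⟨l, hlen, hpw, h0, halt⟩ := exists_alternating_chain hs
  have hlt : (l.map v).IsChain (· < ·) := by
    rw [List.isChain_map]
    have hboth : l.IsChain fun X Y => (X ≠ 0 ∧ Extends X Y) ∧ s X ≠ s Y := by
      rw [List.isChain_iff_getElem] at halt ⊢
      intro i hi
      exact ⟨⟨h0 _ (List.getElem_mem _), List.pairwise_iff_getElem.1 hpw _ _ _ _ (by omega)⟩,
        halt i hi⟩
    refine hboth.imp fun X Y h => ?_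
    exact lt_of_le_of_ne (hmono X Y h.1.1 h.1.2) fun he => h.2 (hsv X Y h.1.1 h.1.2 he)
  have hnd : (l.map v).Nodup := hlt.pairwise.imp fun h => h.ne
  have hsub : (l.map v).toFinset ⊆ Finset.Icc 1 M := by
    intro x hx
    obtain ⟨X, hX, rfl⟩ := List.mem_map.1 (List.mem_toFinset.1 hx)
    exact hv X (h0 X hX)
  have := Finset.card_le_card hsub
  rw [List.toFinset_card_of_nodup hnd, List.length_map, hlen, Nat.card_Icc] at this
  omega

end AlternatingChains

/-! ### The altermatic lower bound for the chromatic number -/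

open AlternatingChains

section Alternation

variable {ι : Type*} [LinearOrder ι]

/-- The finite sets of positions of alternating subsequences of nonzero terms of `X`. -/
def IsAlternation (X : ι → SignType) (s : Finset ι) : Prop :=
  (∀ i ∈ s, X i ≠ 0) ∧
    ∀ i ∈ s, ∀ j ∈ s, i < j → (∀ k ∈ s, ¬ (i < k ∧ k < j)) → X i ≠ X j

theorem IsAlternation.mono {X Y : ι → SignType} {s : Finset ι} (hs : IsAlternation X s)
    (h : Extends X Y) : IsAlternation Y s := by
  have hXY : ∀ i ∈ s, Y i = X i := fun i hi => ((h i).resolve_left (hs.1 i hi)).symm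
  refine ⟨fun i hi => hXY i hi ▸ hs.1 i hi, fun i hi j hj hij hk => ?_⟩
  rw [hXY i hi, hXY j hj]
  exact hs.2 i hi j hj hij hk

theorem IsAlternation.neg {X : ι → SignType} {s : Finset ι} (hs : IsAlternation X s) :
    IsAlternation (-X) s := by
  refine ⟨fun i hi h => hs.1 i hi ?_, fun i hi j hj hij hk h => hs.2 i hi j hj hij hk ?_⟩
  · replace h : -X i = 0 := h
    revert h; cases X i <;> decide
  · exact neg_injective (a₁ := X i) h

theorem IsAlternation.insert {X : ι → SignType} {s : Finset ι} (hs : IsAlternation X s) {i j : ι}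
    (hj : j ∈ s) (hmin : ∀ k ∈ s, j ≤ k) (hij : i < j) (hi : X i ≠ 0) (hne : X i ≠ X j) :
    IsAlternation X (insert i s) := by
  refine ⟨by simpa [hi] using hs.1, fun a ha b hb hab hk => ?_⟩
  rcases Finset.mem_insert.1 ha with rfl | ha
  · rcases Finset.mem_insert.1 hb with rfl | hb
    · exact absurd hab (lt_irrefl _)
    · rcases (hmin b hb).eq_or_lt with rfl | hjb
      · exact hne
      · exact absurd ⟨hij, hjb⟩ (hk j (Finset.mem_insert_of_mem hj))
  · rcases Finset.mem_insert.1 hb with hbi | hb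
    · exact absurd ((hbi ▸ hab).trans hij) (hmin a ha).not_gt
    · exact hs.2 a ha b hb hab fun k hks => hk k (Finset.mem_insert_of_mem hks)

end Alternation

variable {N : ℕ}

theorem IsAlternation.card_le {X : Fin N → SignType} {s : Finset (Fin N)}
    (hs : IsAlternation X s) : s.card ≤ alternationNumber X := by
  classical
  exact Finset.le_sup (f := Finset.card) (Finset.mem_filter.2 ⟨Finset.mem_univ _, hs⟩)

theorem exists_isAlternation_card_eq (X : Fin N → SignType) :
    ∃ s, IsAlternation X s ∧ s.card = alternationNumber X := by
  classical
  obtain ⟨s, hs, h⟩ := Finset.exists_mem_eq_sup (Finset.univ.filter fun s : Finset (Fin N) =>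
    IsAlternation X s) ⟨∅, Finset.mem_filter.2 ⟨Finset.mem_univ _, by simp [IsAlternation]⟩⟩
    Finset.card
  refine ⟨s, (Finset.mem_filter.1 hs).2, h.symm.trans ?_⟩
  unfold alternationNumber IsAlternation
  congr

theorem alternationNumber_mono {X Y : Fin N → SignType} (h : Extends X Y) :
    alternationNumber X ≤ alternationNumber Y := by
  obtain ⟨s, hs, hcard⟩ := exists_isAlternation_card_eq X
  exact hcard ▸ (hs.mono h).card_le

theorem alternationNumber_neg (X : Fin N → SignType) :
    alternationNumber (-X) = alternationNumber X := by
  have h : ∀ X : Fin N → SignType, alternationNumber X ≤ alternationNumber (-X) := by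
    intro X
    obtain ⟨s, hs, hcard⟩ := exists_isAlternation_card_eq X
    exact hcard ▸ hs.neg.card_le
  refine le_antisymm ?_ (h X)
  have h' := h (-X)
  rwa [show - -X = X from funext fun i => neg_neg (X i)] at h'

theorem alternationNumber_pos {X : Fin N → SignType} (h : X ≠ 0) : 0 < alternationNumber X := by
  obtain ⟨i, hi⟩ := Function.ne_iff.1 h
  have : IsAlternation X {i} := by
    refine ⟨by simpa using hi, fun a ha b hb hab => ?_⟩
    rw [Finset.mem_singleton.1 ha, Finset.mem_singleton.1 hb] at hab
    exact absurd hab (lt_irrefl _)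
  exact this.card_le

/-- `ε` is the first sign of a longest alternating subsequence of `X`. -/
def IsLeadingSign (X : Fin N → SignType) (ε : SignType) : Prop :=
  ∃ s, IsAlternation X s ∧ s.card = alternationNumber X ∧ ∃ j ∈ s, (∀ k ∈ s, j ≤ k) ∧ X j = ε

theorem exists_isLeadingSign {X : Fin N → SignType} (h : X ≠ 0) :
    IsLeadingSign X 1 ∨ IsLeadingSign X (-1) := by
  obtain ⟨s, hs, hcard⟩ := exists_isAlternation_card_eq X
  have hne : s.Nonempty := Finset.card_pos.1 (hcard ▸ alternationNumber_pos h)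
  have hj := s.min'_mem hne
  have hsign : X (s.min' hne) = 1 ∨ X (s.min' hne) = -1 := by
    have := hs.1 _ hj
    revert this
    cases X (s.min' hne) <;> decide
  exact hsign.imp (fun h => ⟨s, hs, hcard, _, hj, fun k hk => s.min'_le k hk, h⟩)
    (fun h => ⟨s, hs, hcard, _, hj, fun k hk => s.min'_le k hk, h⟩)

/-- All longest alternating subsequences begin with the same sign: of two that do not, the one that
begins later could be prolonged by the first term of the other. -/
theorem IsLeadingSign.unique {X : Fin N → SignType} {ε δ : SignType} (hε : IsLeadingSign X ε)
    (hδ : IsLeadingSign X δ) : ε = δ := by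
  obtain ⟨s, hs, hcard, i, hi, hmin, rfl⟩ := hε
  obtain ⟨s', hs', hcard', j, hj, hmin', rfl⟩ := hδ
  by_contra hne
  have key : ∀ {s s' : Finset (Fin N)} {i j}, IsAlternation X s → IsAlternation X s' → i ∈ s →
      j ∈ s' → (∀ k ∈ s', j ≤ k) → s'.card = alternationNumber X → X i ≠ X j → ¬ i < j := by
    intro s s' i j hs hs' hi hj hmin' hcard' hne hij
    have h := (hs'.insert hj hmin' hij (hs.1 i hi) hne).card_le
    rw [Finset.card_insert_of_notMem fun h => (hmin' i h).not_gt hij] at h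
    omega
  rcases lt_trichotomy i j with h | rfl | h
  · exact key hs hs' hi hj hmin' hcard' hne h
  · exact hne rfl
  · exact key hs' hs hj hi hmin hcard (Ne.symm hne) h

theorem IsLeadingSign.mono {X Y : Fin N → SignType} {ε : SignType} (h : IsLeadingSign X ε)
    (hXY : Extends X Y) (halt : alternationNumber X = alternationNumber Y) :
    IsLeadingSign Y ε := by
  obtain ⟨s, hs, hcard, i, hi, hmin, rfl⟩ := h
  exact ⟨s, hs.mono hXY, hcard.trans halt, i, hi, hmin, ((hXY i).resolve_left (hs.1 i hi)).symm⟩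

theorem IsLeadingSign.neg {X : Fin N → SignType} {ε : SignType} (h : IsLeadingSign X ε) :
    IsLeadingSign (-X) (-ε) := by
  obtain ⟨s, hs, hcard, i, hi, hmin, rfl⟩ := h
  exact ⟨s, hs.neg, hcard.trans (alternationNumber_neg X).symm, i, hi, hmin, rfl⟩

namespace Hypergraph

variable {α : Type*} {H : Hypergraph α}

theorem signClass_mono {σ : Fin N ≃ H.vertexSet} {X Y : Fin N → SignType} (h : Extends X Y)
    {ε : SignType} (hε : ε ≠ 0) : H.signClass σ X ε ⊆ H.signClass σ Y ε := by
  rintro _ ⟨i, hi, rfl⟩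
  exact ⟨i, by rw [← (h i).resolve_left (hi ▸ hε), hi], rfl⟩

theorem signClass_neg (σ : Fin N ≃ H.vertexSet) (X : Fin N → SignType) (ε : SignType) :
    H.signClass σ (-X) ε = H.signClass σ X (-ε) := by
  ext v
  refine exists_congr fun i => and_congr_left fun _ => ?_
  exact neg_eq_iff_eq_neg (a := X i)

theorem disjoint_signClass (σ : Fin N ≃ H.vertexSet) (X : Fin N → SignType) :
    Disjoint (H.signClass σ X 1) (H.signClass σ X (-1)) := by
  rw [Set.disjoint_left]
  rintro _ ⟨i, hi, rfl⟩ ⟨j, hj, hij⟩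
  rw [σ.injective (Subtype.ext hij), hi] at hj
  exact absurd hj (by decide)

open scoped Classical in
/-- The colours of the hyperedges that lie in the sign class of `ε`. -/
noncomputable def signColors {C : ℕ} (c : H.kneserGraph.Coloring (Fin C)) (σ : Fin N ≃ H.vertexSet)
    (X : Fin N → SignType) (ε : SignType) : Finset (Fin C) :=
  Finset.univ.filter fun k => ∃ e : H.edgeSet, (e : Set α) ⊆ H.signClass σ X ε ∧ c e = k

theorem signColors_mono {C : ℕ} (c : H.kneserGraph.Coloring (Fin C)) {σ : Fin N ≃ H.vertexSet}
    {X Y : Fin N → SignType} (h : Extends X Y) {ε : SignType} (hε : ε ≠ 0) :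
    signColors c σ X ε ⊆ signColors c σ Y ε := by
  classical
  exact Finset.monotone_filter_right _ fun k _ ⟨e, he, hk⟩ => ⟨e, he.trans (signClass_mono h hε), hk⟩

theorem signColors_neg {C : ℕ} (c : H.kneserGraph.Coloring (Fin C)) (σ : Fin N ≃ H.vertexSet)
    (X : Fin N → SignType) (ε : SignType) : signColors c σ (-X) ε = signColors c σ X (-ε) := by
  unfold signColors
  rw [signClass_neg]

theorem disjoint_signColors (hH : ∅ ∉ H.edgeSet) {C : ℕ} (c : H.kneserGraph.Coloring (Fin C))
    (σ : Fin N ≃ H.vertexSet) (X : Fin N → SignType) :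
    Disjoint (signColors c σ X 1) (signColors c σ X (-1)) := by
  classical
  rw [Finset.disjoint_left]
  intro k h1 h2
  obtain ⟨e, he, rfl⟩ := (Finset.mem_filter.1 h1).2
  obtain ⟨f, hf, hfe⟩ := (Finset.mem_filter.1 h2).2
  have hdisj : Disjoint (e : Set α) f := (disjoint_signClass σ X).mono he hf
  refine c.valid (v := e) (w := f) ⟨fun h => ?_, hdisj⟩ hfe.symm
  have hf0 : (f : Set α) = ∅ := disjoint_self.1 (h ▸ hdisj)
  exact hH (hf0 ▸ f.2)

open scoped Classical in
/-- Colourings of the Kneser graph bound the alternation of the orderings from below. Sign vectors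
without hyperedges are labelled by their alternation number and leading sign, all others by the
largest colour of a hyperedge in one of the two sign classes and the sign of that class. -/
theorem le_altOrdering_add (hH : ∅ ∉ H.edgeSet) {C : ℕ} (c : H.kneserGraph.Coloring (Fin C))
    (σ : Fin N ≃ H.vertexSet) : N ≤ H.altOrdering σ + C := by
  set T := H.altOrdering σ
  let W : (Fin N → SignType) → Finset (Fin C) := fun X =>
    signColors c σ X 1 ∪ signColors c σ X (-1)
  let top : (Fin N → SignType) → ℕ := fun X => (W X).sup fun k => (k : ℕ)
  have hWneg : ∀ X, W (-X) = W X := by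
    intro X
    simp only [W, signColors_neg]
    exact Finset.union_comm _ _
  have hWmono : ∀ {X Y}, Extends X Y → W X ⊆ W Y := fun h =>
    Finset.union_subset_union (signColors_mono c h (by decide)) (signColors_mono c h (by decide))
  have hsmall : ∀ X, W X = ∅ → alternationNumber X ≤ T := by
    intro X hX
    refine Finset.le_sup (f := alternationNumber) (Finset.mem_filter.2 ⟨Finset.mem_univ _, ?_⟩)
    intro e he
    have hX' := Finset.union_eq_empty.1 hX
    exact ⟨fun h => Finset.notMem_empty (c ⟨e, he⟩)
        (hX'.1 ▸ Finset.mem_filter.2 ⟨Finset.mem_univ _, ⟨e, he⟩, h, rfl⟩),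
      fun h => Finset.notMem_empty (c ⟨e, he⟩)
        (hX'.2 ▸ Finset.mem_filter.2 ⟨Finset.mem_univ _, ⟨e, he⟩, h, rfl⟩)⟩
  have htop : ∀ X, W X ≠ ∅ → ∃ k ∈ W X, top X = k := fun X hX =>
    Finset.exists_mem_eq_sup _ (Finset.nonempty_iff_ne_empty.2 hX) _
  let s : (Fin N → SignType) → Bool := fun X =>
    if W X = ∅ then decide (IsLeadingSign X 1) else decide (∃ k ∈ signColors c σ X 1, top X = k)
  let v : (Fin N → SignType) → ℕ := fun X =>
    if W X = ∅ then alternationNumber X else T + 1 + top X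
  refine le_of_odd_labelling (s := s) (v := v) ?_ ?_ ?_ ?_
  · intro X h0
    by_cases hX : W X = ∅
    · have hX' : W (-X) = ∅ := (hWneg X).trans hX
      simp only [s, if_pos hX, if_pos hX']
      rw [← decide_not, decide_eq_decide]
      refine ⟨fun h h' => absurd (h.unique h'.neg) (by decide), fun h => ?_⟩
      exact ((exists_isLeadingSign h0).resolve_left h).neg
    · have hX' : W (-X) ≠ ∅ := (hWneg X).trans_ne hX
      have htopX : top (-X) = top X := congrArg (fun w => w.sup fun k : Fin C => (k : ℕ)) (hWneg X)
      simp only [s, if_neg hX, if_neg hX', htopX, signColors_neg]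
      rw [← decide_not, decide_eq_decide]
      obtain ⟨k, hk, hkt⟩ := htop X hX
      have huniq : ∀ l : Fin C, top X = l → l = k := fun l hl => Fin.ext (hl.symm.trans hkt)
      constructor
      · rintro ⟨l, hl, hlt⟩ ⟨l', hl', hlt'⟩
        rw [huniq l hlt] at hl
        rw [huniq l' hlt'] at hl'
        exact Finset.disjoint_left.1 (disjoint_signColors hH c σ X) hl' hl
      · intro h
        refine ⟨k, (Finset.mem_union.1 hk).resolve_left fun h' => h ⟨k, h', hkt⟩, hkt⟩
  · intro X h0
    rw [Finset.mem_Icc]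
    by_cases hX : W X = ∅
    · simp only [v, if_pos hX]
      have := hsmall X hX
      exact ⟨alternationNumber_pos h0, by omega⟩
    · simp only [v, if_neg hX]
      obtain ⟨k, -, hk⟩ := htop X hX
      omega
  · intro X Y h0 hXY
    by_cases hX : W X = ∅
    · by_cases hY : W Y = ∅
      · simpa only [v, if_pos hX, if_pos hY] using alternationNumber_mono hXY
      · simp only [v, if_pos hX, if_neg hY]
        have := hsmall X hX
        omega
    · have hY : W Y ≠ ∅ := fun h => hX (Finset.subset_empty.1 (h ▸ hWmono hXY))
      simp only [v, if_neg hX, if_neg hY]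
      exact Nat.add_le_add_left (Finset.sup_mono (hWmono hXY)) _
  · intro X Y h0 hXY hv
    by_cases hX : W X = ∅
    · by_cases hY : W Y = ∅
      · simp only [v, if_pos hX, if_pos hY] at hv
        simp only [s, if_pos hX, if_pos hY, decide_eq_decide]
        refine ⟨fun h => h.mono hXY hv, fun h => ?_⟩
        exact (exists_isLeadingSign h0).resolve_right fun h' =>
          absurd (h.unique (h'.mono hXY hv)) (by decide)
      · simp only [v, if_pos hX, if_neg hY] at hv
        have := hsmall X hX
        omega
    · have hY : W Y ≠ ∅ := fun h => hX (Finset.subset_empty.1 (h ▸ hWmono hXY))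
      simp only [v, if_neg hX, if_neg hY] at hv
      have htopXY : top X = top Y := by omega
      simp only [s, if_neg hX, if_neg hY, decide_eq_decide, ← htopXY]
      obtain ⟨k, hk, hkt⟩ := htop X hX
      constructor
      · rintro ⟨l, hl, hlt⟩
        exact ⟨l, signColors_mono c hXY (by decide) hl, hlt⟩
      · rintro ⟨l, hl, hlt⟩
        have hlk : l = k := Fin.ext (hlt.symm.trans hkt)
        subst hlk
        refine ⟨l, (Finset.mem_union.1 hk).resolve_right fun h' => ?_, hlt⟩
        exact Finset.disjoint_left.1 (disjoint_signColors hH c σ Y) hl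
          (signColors_mono c hXY (by decide) h')

theorem nonempty_ordering (hfin : H.vertexSet.Finite) :
    Nonempty (Fin H.vertexSet.ncard ≃ H.vertexSet) := by
  have := hfin.to_subtype
  exact ⟨(Finite.equivFinOfCardEq (Nat.card_coe_set_eq _)).symm⟩

theorem ncard_sub_alt_le (hfin : H.vertexSet.Finite) (hH : ∅ ∉ H.edgeSet) {C : ℕ}
    (hC : H.kneserGraph.Colorable C) : H.vertexSet.ncard - H.alt ≤ C := by
  obtain ⟨c⟩ := hC
  have := nonempty_ordering hfin
  obtain ⟨σ, hσ⟩ := Nat.sInf_mem (Set.range_nonempty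
    fun σ : Fin H.vertexSet.ncard ≃ H.vertexSet => H.altOrdering σ)
  have h : H.altOrdering σ = H.alt := hσ
  have := le_altOrdering_add hH c σ
  omega

end Hypergraph

theorem SimpleGraph.le_of_mem_altermaticValues {V : Type*} {G : SimpleGraph V} {C k : ℕ}
    (hC : G.Colorable C) (hk : k ∈ G.altermaticValues) : k ≤ C := by
  obtain ⟨α, H, hfin, hH, ⟨f⟩, -, rfl⟩ := hk
  exact Hypergraph.ncard_sub_alt_le hfin hH (hC.of_hom f)

/-! ### Alternation in a linearly ordered vertex set -/

section Alternation

variable {ι : Type*} [LinearOrder ι]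

theorem IsAlternation.of_convex {X : ι → SignType} {s t : Finset ι} (hs : IsAlternation X s)
    (hts : t ⊆ s) (ht : ∀ i ∈ t, ∀ j ∈ t, ∀ k ∈ s, i < k → k < j → k ∈ t) : IsAlternation X t :=
  ⟨fun i hi => hs.1 i (hts hi), fun i hi j hj hij hk => hs.2 i (hts hi) j (hts hj) hij
    fun k hks h => hk k (ht i hi j hj k hks h.1 h.2) h⟩

theorem IsAlternation.apply_orderEmbOfFin_succ {X : ι → SignType} {s : Finset ι}
    (hs : IsAlternation X s) {k : ℕ} (hk : k + 1 < s.card) :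
    X (s.orderEmbOfFin rfl ⟨k + 1, hk⟩) = -X (s.orderEmbOfFin rfl ⟨k, by omega⟩) := by
  have h₁ := hs.1 _ (s.orderEmbOfFin_mem rfl ⟨k + 1, hk⟩)
  have h₂ := hs.1 _ (s.orderEmbOfFin_mem rfl ⟨k, by omega⟩)
  have h₃ := hs.2 _ (s.orderEmbOfFin_mem rfl ⟨k, by omega⟩) _
    (s.orderEmbOfFin_mem rfl ⟨k + 1, hk⟩) ((s.orderEmbOfFin rfl).strictMono (by simp)) (by
      intro x hx h
      obtain ⟨l, rfl⟩ : x ∈ Set.range (s.orderEmbOfFin rfl) := by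
        rw [Finset.range_orderEmbOfFin]; exact hx
      have h₁ := (s.orderEmbOfFin rfl).lt_iff_lt.1 h.1
      have h₂ := (s.orderEmbOfFin rfl).lt_iff_lt.1 h.2
      rw [Fin.lt_def] at h₁ h₂
      simp only at h₁ h₂
      omega)
  revert h₁ h₂ h₃
  cases X (s.orderEmbOfFin rfl ⟨k + 1, hk⟩) <;> cases X (s.orderEmbOfFin rfl ⟨k, by omega⟩) <;>
    decide

/-- Among the first `2 * r` terms of an alternation, `r` terms have any given sign. Two of them
are never neighbours, not even cyclically: the first and the last of the `2 * r` terms have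
different signs. -/
theorem IsAlternation.exists_sparse {Y : ℕ → SignType} {s : Finset ℕ} (hs : IsAlternation Y s)
    {L r : ℕ} (hL : ∀ u ∈ s, u < L) (hr : 2 * r ≤ s.card) {ε : SignType} (hε : ε ≠ 0) :
    ∃ g : Fin r → ℕ, (∀ j, g j < L ∧ Y (g j) = ε) ∧ (∀ j k, j < k → g j + 1 < g k) ∧
      ∀ j k, ¬ (g j = 0 ∧ g k = L - 1) := by
  set f := s.orderEmbOfFin rfl with hf
  have hmono : ∀ {a b : ℕ} (ha : a < s.card) (hb : b < s.card), a < b → f ⟨a, ha⟩ < f ⟨b, hb⟩ :=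
    fun ha hb hab => f.strictMono hab
  have hlt : ∀ a : Fin s.card, f a < L := fun a => hL _ (s.orderEmbOfFin_mem rfl a)
  obtain ⟨c, hc, hsign⟩ : ∃ c < 2, ∀ j (hj : 2 * j + c < s.card), j < r →
      Y (f ⟨2 * j + c, hj⟩) = ε := by
    rcases Nat.eq_zero_or_pos r with rfl | hr0
    · exact ⟨0, by omega, fun j _ hj => by omega⟩
    have h₀ := hs.1 _ (s.orderEmbOfFin_mem rfl ⟨0, by omega⟩)
    have h₁ := hs.apply_orderEmbOfFin_succ (k := 0) (by omega)
    have hstart : ∃ c < 2, ∃ h : c < s.card, Y (f ⟨c, h⟩) = ε := by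
      by_cases h : Y (f ⟨0, by omega⟩) = ε
      · exact ⟨0, by omega, by omega, h⟩
      · refine ⟨1, by omega, by omega, ?_⟩
        rw [← hf] at h₀ h₁
        revert h₀ h₁ h hε
        generalize Y (f ⟨0, _⟩) = p
        generalize Y (f ⟨0 + 1, _⟩) = q
        revert p q ε
        decide
    obtain ⟨c, hc, hcs, hstart⟩ := hstart
    refine ⟨c, hc, fun j => ?_⟩
    induction j with
    | zero => intro h _; simpa using hstart
    | succ j ih =>
      intro h hj
      have h₁ := hs.apply_orderEmbOfFin_succ (k := 2 * j + c) (by omega)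
      have h₂ := hs.apply_orderEmbOfFin_succ (k := 2 * j + c + 1) (by omega)
      rw [h₁, ← hf, ih (by omega) (by omega)] at h₂
      have he : (⟨2 * (j + 1) + c, h⟩ : Fin s.card) = ⟨2 * j + c + 1 + 1, by omega⟩ := by
        ext; simp only; omega
      rw [he, h₂]
      exact neg_neg ε
  refine ⟨fun j => f ⟨2 * j + c, by omega⟩, fun j => ⟨hlt _, hsign _ _ j.2⟩, fun j k hjk => ?_,
    fun j k hjk => ?_⟩
  · have h₁ := hmono (a := 2 * j + c) (b := 2 * j + c + 1) (by omega) (by omega) (by omega)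
    have h₂ := hmono (a := 2 * j + c + 1) (b := 2 * k + c) (by omega) (by omega) (by omega)
    simp only
    omega
  · have hj := j.2
    have hk := k.2
    rcases Nat.lt_or_ge c 1 with hc0 | hc1
    · have h₁ := hmono (a := 2 * k + c) (b := 2 * k + c + 1) (by omega) (by omega) (by omega)
      have h₂ := hlt ⟨2 * k + c + 1, by omega⟩
      simp only at hjk
      omega
    · have h₁ := hmono (a := 0) (b := 2 * j + c) (by omega) (by omega) (by omega)
      simp only at hjk
      omega

/-- The alternation of a hypergraph is bounded by that of any linear order on its vertices. -/
theorem Hypergraph.alt_le {H : Hypergraph ι} (hfin : H.vertexSet.Finite) {B : ℕ}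
    (h : ∀ (X : ι → SignType) (s : Finset ι), (∀ p ∈ s, p ∈ H.vertexSet) → IsAlternation X s →
      B < s.card → ∃ ε, (ε = 1 ∨ ε = -1) ∧ ∃ e ∈ H.edgeSet, ∀ p ∈ e, X p = ε) : H.alt ≤ B := by
  classical
  obtain ⟨f, hf⟩ : ∃ f : Fin H.vertexSet.ncard ↪o ι, Set.range f = H.vertexSet :=
    ⟨hfin.toFinset.orderEmbOfFin (Set.ncard_eq_toFinset_card _ hfin).symm, by simp⟩
  have hfmem : ∀ i, f i ∈ H.vertexSet := fun i => hf.subset (Set.mem_range_self i)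
  have hfsurj : ∀ p ∈ H.vertexSet, ∃ i, f i = p := fun p hp => by rwa [← hf] at hp
  let σ : Fin H.vertexSet.ncard ≃ H.vertexSet := Equiv.ofBijective (fun i => ⟨f i, hfmem i⟩)
    ⟨fun i j hij => f.injective (congrArg Subtype.val hij),
      fun p => (hfsurj p p.2).imp fun i hi => Subtype.ext hi⟩
  refine (Nat.sInf_le ⟨σ, rfl⟩ : H.alt ≤ H.altOrdering σ).trans (Finset.sup_le fun X hX => ?_)
  by_contra hlt
  obtain ⟨s, hs, hscard⟩ := exists_isAlternation_card_eq X
  have hX' : ∀ i, Function.extend f X 0 (f i) = X i := fun i => f.injective.extend_apply X 0 i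
  obtain ⟨ε, hε, e, he, heX⟩ := h (Function.extend f X 0) (s.map f.toEmbedding) (by
      intro p hp
      obtain ⟨i, -, rfl⟩ := Finset.mem_map.1 hp
      exact hfmem i) (by
      refine ⟨fun p hp => ?_, fun p hp q hq hpq hk => ?_⟩
      · obtain ⟨i, hi, rfl⟩ := Finset.mem_map.1 hp
        exact (hX' i).trans_ne (hs.1 i hi)
      · obtain ⟨i, hi, rfl⟩ := Finset.mem_map.1 hp
        obtain ⟨j, hj, rfl⟩ := Finset.mem_map.1 hq
        refine (hX' i).trans_ne (Ne.trans_eq ?_ (hX' j).symm)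
        refine hs.2 i hi j hj (f.lt_iff_lt.1 hpq) fun k hks hkk => ?_
        exact hk (f k) (Finset.mem_map_of_mem _ hks) ⟨f.lt_iff_lt.2 hkk.1, f.lt_iff_lt.2 hkk.2⟩)
      (by rw [Finset.card_map, hscard]; omega)
  have hclass : e ⊆ H.signClass σ X ε := by
    intro p hp
    obtain ⟨i, rfl⟩ := hfsurj p (H.subset_vertexSet_of_mem_edgeSet' he hp)
    exact ⟨i, (hX' i).symm.trans (heX _ hp), rfl⟩
  have hboth := (Finset.mem_filter.1 hX).2 e he
  rcases hε with rfl | rfl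
  · exact hboth.1 hclass
  · exact hboth.2 hclass

/-- An alternation in a lexicographic product restricts to an alternation in one of the factors
that is at least as long as the average. -/
theorem IsAlternation.exists_block {X : ℕ ×ₗ ℕ → SignType} {s : Finset (ℕ ×ₗ ℕ)}
    (hs : IsAlternation X s) {h L B : ℕ} (hsub : ∀ p ∈ s, (ofLex p).1 < h ∧ (ofLex p).2 < L)
    (hcard : h * B < s.card) : ∃ i < h, ∃ t : Finset ℕ, (∀ u ∈ t, u < L) ∧ B < t.card ∧
      IsAlternation (fun u => X (toLex (i, u))) t := by
  classical
  obtain ⟨i, hi, hB⟩ := Finset.exists_lt_card_fiber_of_mul_lt_card_of_maps_to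
    (s := s) (t := Finset.range h) (f := fun p => (ofLex p).1) (n := B)
    (fun p hp => Finset.mem_range.2 (hsub p hp).1) (by simpa using hcard)
  obtain ⟨t, hmem, htcard⟩ : ∃ t : Finset ℕ, (∀ u, u ∈ t ↔ toLex (i, u) ∈ s) ∧ B < t.card := by
    refine ⟨(s.filter fun p => (ofLex p).1 = i).image fun p => (ofLex p).2, fun u => ?_, ?_⟩
    · simp only [Finset.mem_image, Finset.mem_filter]
      constructor
      · rintro ⟨p, ⟨hp, rfl⟩, rfl⟩
        exact hp
      · exact fun hu => ⟨_, ⟨hu, rfl⟩, rfl⟩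
    · rw [Finset.card_image_of_injOn]
      · exact hB
      · intro p hp q hq hpq
        have hp' := (Finset.mem_filter.1 (Finset.mem_coe.1 hp)).2
        have hq' := (Finset.mem_filter.1 (Finset.mem_coe.1 hq)).2
        exact ofLex.injective (Prod.ext (hp'.trans hq'.symm) hpq)
  have hlt : ∀ u v : ℕ, toLex (i, u) < toLex (i, v) ↔ u < v := by
    intro u v
    simp [Prod.Lex.toLex_lt_toLex]
  refine ⟨i, Finset.mem_range.1 hi, t, fun u hu => (hsub _ ((hmem u).1 hu)).2, htcard,
    fun u hu => hs.1 _ ((hmem u).1 hu), fun u hu v hv huv hk => ?_⟩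
  refine hs.2 _ ((hmem u).1 hu) _ ((hmem v).1 hv) ((hlt u v).2 huv) fun p hp hpp => ?_
  induction p using Lex.rec with | _ p =>
  obtain ⟨j, w⟩ := p
  have h₁ := Prod.Lex.toLex_lt_toLex.1 hpp.1
  have h₂ := Prod.Lex.toLex_lt_toLex.1 hpp.2
  obtain rfl : j = i := by simp only at h₁ h₂; omega
  exact hk w ((hmem w).2 hp) ⟨(hlt _ _).1 hpp.1, (hlt _ _).1 hpp.2⟩

end Alternation

/-! ### Matchings of a fixed size in a complete bipartite graph -/

namespace MatchingKneser

open SimpleGraph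

/-- The vertices of `KG(K_{m,n}, rK₂)`: the matchings with `r` edges in `K_{m,n}`. -/
abbrev Matching (m n r : ℕ) : Type :=
  {K : (completeBipartiteGraph (Fin m) (Fin n)).Subgraph // Nonempty (matchingGraph r ≃g K.coe)}

variable {m n r : ℕ}

theorem Matching.exists_edges (M : Matching m n r) :
    ∃ (a : Fin r → Fin m) (b : Fin r → Fin n), Function.Injective b ∧
      ∀ j, M.1.Adj (Sum.inl (a j)) (Sum.inr (b j)) := by
  obtain ⟨φ⟩ := M.2
  have h : ∀ j, ∃ (a : Fin m) (b : Fin n), M.1.Adj (Sum.inl a) (Sum.inr b) ∧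
      ∃ c, (φ (j, c)).1 = Sum.inr b := by
    intro j
    have hadj : M.1.Adj (φ (j, 0)).1 (φ (j, 1)).1 :=
      φ.map_adj_iff.2 (show (matchingGraph r).Adj (j, 0) (j, 1) from
        ⟨rfl, show (0 : Fin 2) ≠ 1 by decide⟩)
    have hG := M.1.adj_sub hadj
    rcases hu : (φ (j, 0)).1 with a | b <;> rcases hv : (φ (j, 1)).1 with a' | b' <;>
      rw [hu, hv] at hadj hG
    · simp at hG
    · exact ⟨a, b', hadj, 1, hv⟩
    · exact ⟨a', b, hadj.symm, 0, hu⟩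
    · simp at hG
  choose a b hab c hc using h
  refine ⟨a, b, fun j k hjk => ?_, hab⟩
  have : φ (j, c j) = φ (k, c k) := Subtype.ext ((hc j).trans (hjk ▸ (hc k).symm))
  exact congrArg Prod.fst (φ.injective this)

theorem exists_matching {a : Fin r → Fin m} {b : Fin r → Fin n} (ha : Function.Injective a)
    (hb : Function.Injective b) : ∃ M : Matching m n r,
      ∀ x y, M.1.Adj (Sum.inl x) (Sum.inr y) → ∃ j, a j = x ∧ b j = y := by
  let φ : matchingGraph r →g completeBipartiteGraph (Fin m) (Fin n) :=
    { toFun := fun p => if p.2 = 0 then Sum.inl (a p.1) else Sum.inr (b p.1)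
      map_rel' := by
        rintro ⟨i, c⟩ ⟨j, d⟩ ⟨-, hcd⟩
        fin_cases c <;> fin_cases d <;> simp_all }
  have hφ : Function.Injective φ := by
    rintro ⟨i, c⟩ ⟨j, d⟩ h
    change (if c = 0 then Sum.inl (a i) else Sum.inr (b i)) =
      (if d = 0 then Sum.inl (a j) else Sum.inr (b j) : Fin m ⊕ Fin n) at h
    fin_cases c <;> fin_cases d <;> simp_all [ha.eq_iff, hb.eq_iff]
  let f : Copy (matchingGraph r) (completeBipartiteGraph (Fin m) (Fin n)) := ⟨φ, hφ⟩
  refine ⟨⟨f.toSubgraph, ⟨f.isoToSubgraph⟩⟩, fun x y h => ?_⟩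
  obtain ⟨⟨i, c⟩, ⟨j, d⟩, hadj, hx, hy⟩ := h
  obtain ⟨rfl, -⟩ : (matchingGraph r).Adj (i, c) (j, d) := hadj
  refine ⟨i, ?_⟩
  change (if c = 0 then Sum.inl (a i) else Sum.inr (b i)) = (Sum.inl x : Fin m ⊕ Fin n) at hx
  change (if d = 0 then Sum.inl (a i) else Sum.inr (b i)) = (Sum.inr y : Fin m ⊕ Fin n) at hy
  split_ifs at hx hy
  simp_all

theorem edgeSet_disjoint_of_forall {M M' : Matching m n r}
    (h : ∀ x y, M.1.Adj (Sum.inl x) (Sum.inr y) → ¬ M'.1.Adj (Sum.inl x) (Sum.inr y)) :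
    Disjoint M.1.edgeSet M'.1.edgeSet := by
  rw [Set.disjoint_left]
  intro e
  induction e with | _ u v =>
  intro hM hM'
  rw [Subgraph.mem_edgeSet] at hM hM'
  have hG := M.1.adj_sub hM
  rcases u with x | x <;> rcases v with y | y
  · simp at hG
  · exact h x y hM hM'
  · exact h y x hM.symm hM'.symm
  · simp at hG

theorem not_adj_of_edgeSet_disjoint {M M' : Matching m n r}
    (h : Disjoint M.1.edgeSet M'.1.edgeSet) {u v} (hM : M.1.Adj u v) : ¬ M'.1.Adj u v := fun hM' =>
  Set.disjoint_left.1 h (Subgraph.mem_edgeSet.2 hM) (Subgraph.mem_edgeSet.2 hM')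

/-- Among the `r` edges of a matching one avoids the first `r - 1` vertices of the second part;
it serves as the colour of the matching. -/
theorem colorable (hr : 0 < r) (hrn : r ≤ n) :
    ((completeBipartiteGraph (Fin m) (Fin n)).kneserGraphOf (matchingGraph r)).Colorable
      (m * (n - r + 1)) := by
  have h : ∀ M : Matching m n r, ∃ (a : Fin m) (b : Fin n), M.1.Adj (Sum.inl a) (Sum.inr b) ∧
      r - 1 ≤ b := by
    intro M
    obtain ⟨a, b, hb, hab⟩ := M.exists_edges
    by_contra! hlt
    have := Fintype.card_le_of_injective (fun j => (⟨b j, hlt _ _ (hab j)⟩ : Fin (r - 1)))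
      fun j k hjk => hb (Fin.ext (by simpa using hjk))
    simp only [Fintype.card_fin] at this
    omega
  choose a b hab hb using h
  let c : ((completeBipartiteGraph (Fin m) (Fin n)).kneserGraphOf (matchingGraph r)).Coloring
      (Fin m × Fin (n - r + 1)) := Coloring.mk
    (fun M => (a M, ⟨b M - (r - 1), by have := (b M).2; have := hb M; omega⟩)) (by
      intro M M' hMM' heq
      obtain ⟨ha, hb'⟩ := Prod.ext_iff.1 heq
      have hbb : b M = b M' := by
        have h₁ := Fin.ext_iff.1 hb'
        simp only at h₁
        have := hb M
        have := hb M'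
        ext
        omega
      refine not_adj_of_edgeSet_disjoint hMM'.2 (hab M) ?_
      rw [show a M = a M' from ha, hbb]
      exact hab M')
  simpa using c.colorable

/-! ### A hypergraph with the same Kneser graph up to homomorphic equivalence -/

/-- The index of the trail in which the edge `(a, b)` lies. The edges of `K_{m,n}` are split into `m / 2` trails
with `2 * n` edges each: the `t`-th edge of the `i`-th trail joins the vertices
`(t + 1) / 2 + 2 * i` (modulo `m`) and `t / 2`. -/
def trail (a : Fin m) (b : Fin n) : ℕ := (a + m - b) % m / 2

/-- The position of the edge `(a, b)` in its trail. -/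
def position (a : Fin m) (b : Fin n) : ℕ := 2 * b + (a + m - b) % m % 2

theorem trail_lt (hm : Even m) (a : Fin m) (b : Fin n) : trail a b < m / 2 := by
  have := Nat.mod_lt (a + m - b : ℕ) (show 0 < m by have := a.2; omega)
  obtain ⟨k, rfl⟩ := hm
  unfold trail
  omega

theorem position_lt (a : Fin m) (b : Fin n) : position a b < 2 * n := by
  have := b.2
  unfold position
  omega

theorem eq_of_trail_eq_of_position_eq (hnm : n ≤ m) {a a' : Fin m} {b b' : Fin n}
    (h : trail a b = trail a' b') (h' : position a b = position a' b') : a = a' ∧ b = b' := by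
  unfold trail at h
  unfold position at h'
  obtain rfl : b = b' := Fin.ext (by omega)
  have hmod : (a + m - b : ℕ) ≡ a' + m - b [MOD m] := by
    unfold Nat.ModEq
    omega
  have hb := b.2
  have hadd := hmod.add_right b
  rw [Nat.sub_add_cancel (by omega), Nat.sub_add_cancel (by omega)] at hadd
  have h := Nat.ModEq.add_right_cancel' m hadd
  exact ⟨Fin.ext (h.eq_of_lt_of_lt a.2 a'.2), rfl⟩

theorem exists_trail_position (hm : Even m) (hnm : n ≤ m) {i t : ℕ} (hi : i < m / 2)
    (ht : t < 2 * n) : ∃ (a : Fin m) (b : Fin n), (a : ℕ) = ((t + 1) / 2 + 2 * i) % m ∧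
      (b : ℕ) = t / 2 ∧ trail a b = i ∧ position a b = t := by
  have hm0 : 0 < m := by omega
  refine ⟨⟨_, Nat.mod_lt ((t + 1) / 2 + 2 * i) hm0⟩, ⟨t / 2, by omega⟩, rfl, rfl, ?_⟩
  have key : (((t + 1) / 2 + 2 * i) % m + m - t / 2) % m = 2 * i + t % 2 := by
    have hq : 2 * i + t % 2 < m := by obtain ⟨k, rfl⟩ := hm; omega
    rcases Nat.lt_or_ge ((t + 1) / 2 + 2 * i) m with h | h
    · rw [Nat.mod_eq_of_lt h, show (t + 1) / 2 + 2 * i + m - t / 2 = 2 * i + t % 2 + m by omega,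
        Nat.add_mod_right, Nat.mod_eq_of_lt hq]
    · have h' : ((t + 1) / 2 + 2 * i) % m = (t + 1) / 2 + 2 * i - m := by
        rw [Nat.mod_eq_sub_mod h, Nat.mod_eq_of_lt (by omega)]
      rw [h', show (t + 1) / 2 + 2 * i - m + m - t / 2 = 2 * i + t % 2 by omega,
        Nat.mod_eq_of_lt hq]
  unfold trail position
  simp only [key]
  omega

/-- The set `F` of vertices claims the `t`-th edge of the `i`-th trail. The vertex `(i, t)` with
`t < 2 * n` stands for the edge itself; beyond these, the `i`-th block of vertices contains a tail
of `2 * n` pairs, of which only the first members `(i, 2 * n + 2 * t')` count. A set that claims the edge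
in the first way meets every other set that does so, in `(i, t)`, and every set that claims it in
the second way, in the tail. -/
def Claims (n : ℕ) (F : Set (ℕ ×ₗ ℕ)) (i t : ℕ) : Prop :=
  (toLex (i, t) ∈ F ∧ ∃ t' < 2 * n, toLex (i, 2 * n + 2 * t') ∈ F) ∨
    ∀ t' < 2 * n, toLex (i, 2 * n + 2 * t') ∈ F

theorem not_claims_of_disjoint {F F' : Set (ℕ ×ₗ ℕ)} (h : Disjoint F F') {i t : ℕ} (ht : t < 2 * n)
    (hF : Claims n F i t) : ¬ Claims n F' i t := by
  rw [Set.disjoint_left] at h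
  rintro (⟨h₁, s', hs', h₂⟩ | h₁)
  · rcases hF with ⟨h₃, -⟩ | h₃
    · exact h h₃ h₁
    · exact h (h₃ s' hs') h₂
  · rcases hF with ⟨-, s, hs, h₃⟩ | h₃
    · exact h h₃ (h₁ s hs)
    · exact h (h₃ t ht) (h₁ t ht)

/-- `F` claims all edges of the matching `M`. -/
def ClaimsMatching (F : Set (ℕ ×ₗ ℕ)) (M : Matching m n r) : Prop :=
  ∀ a b, M.1.Adj (Sum.inl a) (Sum.inr b) → Claims n F (trail a b) (position a b)

/-- The hypergraph of the sets that claim a matching with `r` edges. Its vertices come in `m / 2`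
blocks of `6 * n`: the `2 * n` edges of a trail, followed by a tail of `4 * n` vertices. -/
def claimHypergraph (m n r : ℕ) : Hypergraph (ℕ ×ₗ ℕ) where
  vertexSet := {p | (ofLex p).1 < m / 2 ∧ (ofLex p).2 < 6 * n}
  edgeSet := {F | (∀ p ∈ F, (ofLex p).1 < m / 2 ∧ (ofLex p).2 < 6 * n) ∧
    ∃ M : Matching m n r, ClaimsMatching F M}
  subset_vertexSet_of_mem_edgeSet' := fun _ hF => hF.1

theorem vertexSet_eq (m n r : ℕ) : (claimHypergraph m n r).vertexSet =
    ((Finset.range (m / 2) ×ˢ Finset.range (6 * n)).map toLex.toEmbedding : Finset (ℕ ×ₗ ℕ)) := by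
  ext p
  simp [claimHypergraph]

theorem ncard_vertexSet (m n r : ℕ) :
    (claimHypergraph m n r).vertexSet.ncard = m / 2 * (6 * n) := by
  rw [vertexSet_eq, Set.ncard_coe_finset, Finset.card_map, Finset.card_product, Finset.card_range,
    Finset.card_range]

theorem finite_vertexSet (m n r : ℕ) : (claimHypergraph m n r).vertexSet.Finite := by
  rw [vertexSet_eq]
  exact Finset.finite_toSet _

theorem empty_notMem_edgeSet (hr : 0 < r) (hrn : r ≤ n) :
    ∅ ∉ (claimHypergraph m n r).edgeSet := by
  rintro ⟨-, M, hM⟩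
  obtain ⟨a, b, -, hab⟩ := M.exists_edges
  rcases hM _ _ (hab ⟨0, hr⟩) with ⟨h, -⟩ | h
  · exact h
  · exact h 0 (by omega)

theorem Matching.ne_of_disjoint (hr : 0 < r) {M M' : Matching m n r}
    (h : Disjoint M.1.edgeSet M'.1.edgeSet) : M ≠ M' := by
  rintro rfl
  obtain ⟨a, b, -, hab⟩ := M.exists_edges
  exact not_adj_of_edgeSet_disjoint h (hab ⟨0, hr⟩) (hab ⟨0, hr⟩)

theorem nonempty_hom (hr : 0 < r) : Nonempty ((claimHypergraph m n r).kneserGraph →g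
    (completeBipartiteGraph (Fin m) (Fin n)).kneserGraphOf (matchingGraph r)) := by
  have h : ∀ F : (claimHypergraph m n r).edgeSet, ∃ M : Matching m n r, ClaimsMatching F.1 M :=
    fun F => F.2.2
  choose f hf using h
  refine ⟨⟨f, fun {F F'} hFF' => ?_⟩⟩
  have hdisj : Disjoint (f F).1.edgeSet (f F').1.edgeSet :=
    edgeSet_disjoint_of_forall fun a b hab hab' =>
      not_claims_of_disjoint hFF'.2 (position_lt a b) (hf F a b hab) (hf F' a b hab')
  exact ⟨Matching.ne_of_disjoint hr hdisj, hdisj⟩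

/-- The set associated to a matching contains for each of its edges the vertex that stands for the
edge and one vertex of the tail of the block that counts. -/
def claimSet (M : Matching m n r) : Set (ℕ ×ₗ ℕ) :=
  {p | ∃ a b, M.1.Adj (Sum.inl a) (Sum.inr b) ∧ (p = toLex (trail a b, position a b) ∨
    p = toLex (trail a b, 2 * n + 2 * position a b))}

theorem claimSet_mem_edgeSet (hm : Even m) (M : Matching m n r) :
    claimSet M ∈ (claimHypergraph m n r).edgeSet := by
  refine ⟨?_, M, fun a b hab => Or.inl ⟨⟨a, b, hab, Or.inl rfl⟩, position a b, position_lt a b,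
    ⟨a, b, hab, Or.inr rfl⟩⟩⟩
  rintro p ⟨a, b, -, rfl | rfl⟩
  · have := position_lt a b
    exact ⟨trail_lt hm a b, show position a b < 6 * n by omega⟩
  · have := position_lt a b
    exact ⟨trail_lt hm a b, show 2 * n + 2 * position a b < 6 * n by omega⟩

theorem nonempty_hom' (hm : Even m) (hnm : n ≤ m) (hr : 0 < r) (hrn : r ≤ n) :
    Nonempty ((completeBipartiteGraph (Fin m) (Fin n)).kneserGraphOf (matchingGraph r) →g
      (claimHypergraph m n r).kneserGraph) := by
  refine ⟨⟨fun M => ⟨claimSet M, claimSet_mem_edgeSet hm M⟩, fun {M M'} hMM' => ?_⟩⟩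
  have hdisj : Disjoint (claimSet M) (claimSet M') := by
    rw [Set.disjoint_left]
    rintro p ⟨a, b, hab, hp⟩ ⟨a', b', hab', hp'⟩
    have hpos := position_lt a b
    have hpos' := position_lt a' b'
    have h : trail a b = trail a' b' ∧ position a b = position a' b' := by
      rcases hp with rfl | rfl <;> rcases hp' with h | h <;>
        have h₁ := congrArg (fun p => (ofLex p).1) h <;>
        have h₂ := congrArg (fun p => (ofLex p).2) h <;> simp only [ofLex_toLex] at h₁ h₂ <;>
        exact ⟨h₁, by omega⟩
    obtain ⟨rfl, rfl⟩ := eq_of_trail_eq_of_position_eq hnm h.1 h.2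
    exact not_adj_of_edgeSet_disjoint hMM'.2 hab hab'
  refine ⟨fun h => ?_, hdisj⟩
  have h' : claimSet M = claimSet M' := congrArg Subtype.val h
  rw [← h'] at hdisj
  have h0 : claimSet M = ∅ := disjoint_self.1 hdisj
  exact empty_notMem_edgeSet (m := m) hr hrn (h0 ▸ claimSet_mem_edgeSet hm M)

/-! ### The alternation of the hypergraph -/

/-- Edges of one trail whose positions are not cyclic neighbours form a matching. -/
theorem exists_matching_of_sparse (hm : Even m) (hnm : n ≤ m) {i : ℕ} (hi : i < m / 2)
    {g : Fin r → ℕ} (hlt : ∀ j, g j < 2 * n) (hg : ∀ j k, j < k → g j + 1 < g k)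
    (hcyc : ∀ j k, ¬ (g j = 0 ∧ g k = 2 * n - 1)) :
    ∃ M : Matching m n r, ∀ a b, M.1.Adj (Sum.inl a) (Sum.inr b) →
      trail a b = i ∧ ∃ j, position a b = g j := by
  choose a b ha hb htrail hpos using fun j => exists_trail_position hm hnm hi (hlt j)
  have hne : ∀ {j k}, j ≠ k → g j + 1 < g k ∨ g k + 1 < g j := fun hjk =>
    (lt_or_gt_of_ne hjk).imp (hg _ _) (hg _ _)
  have ha_inj : Function.Injective a := by
    intro j k hjk
    by_contra h
    have hmod : ((g j + 1) / 2 + 2 * i) % m = ((g k + 1) / 2 + 2 * i) % m := by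
      rw [← ha j, ← ha k, hjk]
    have hmod' : (g j + 1) / 2 ≡ (g k + 1) / 2 [MOD m] := Nat.ModEq.add_right_cancel' _ hmod
    have hj := hlt j
    have hk := hlt k
    have key : ∀ j k, g j + 1 < g k → ¬ ((g j + 1) / 2 ≡ (g k + 1) / 2 [MOD m]) := by
      intro j k hjk hmod
      have hk := hlt k
      have hdvd := (Nat.modEq_iff_dvd' (by omega)).1 hmod
      have hle := Nat.le_of_dvd (by omega) hdvd
      exact hcyc j k (by omega)
    rcases hne h with h | h
    · exact key j k h hmod'
    · exact key k j h hmod'.symm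
  have hb_inj : Function.Injective b := by
    intro j k hjk
    by_contra h
    have := hb j
    have := hb k
    rw [hjk] at *
    rcases hne h with h | h <;> omega
  obtain ⟨M, hM⟩ := exists_matching ha_inj hb_inj
  refine ⟨M, fun x y hxy => ?_⟩
  obtain ⟨j, rfl, rfl⟩ := hM x y hxy
  exact ⟨htrail j, j, hpos j⟩

/-- A long alternation in a block claims a matching in one of its signs. If it has at least `2 * r`
terms in the trail, both signs contain a matching there, and it only remains to find a term in the
tail. Otherwise the tail is used up completely, so that all its vertices that count have the same
sign. -/
theorem exists_claims_of_isAlternation {Y : ℕ → SignType} {s : Finset ℕ} (hs : IsAlternation Y s)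
    (hr : 0 < r) (hrn : r ≤ n) (hlt : ∀ u ∈ s, u < 6 * n) (hcard : 2 * (r - 1) + 4 * n < s.card) :
    ∃ ε, ε ≠ 0 ∧ ∃ g : Fin r → ℕ, (∀ j, g j < 2 * n) ∧ (∀ j k, j < k → g j + 1 < g k) ∧
      (∀ j k, ¬ (g j = 0 ∧ g k = 2 * n - 1)) ∧
      ((∀ j, Y (g j) = ε ∧ ∃ t' < 2 * n, Y (2 * n + 2 * t') = ε) ∨
        ∀ t' < 2 * n, Y (2 * n + 2 * t') = ε) := by
  have hsum := Finset.card_filter_add_card_filter_not (s := s) (fun u => u < 2 * n)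
  have hA : IsAlternation Y (s.filter fun u => u < 2 * n) :=
    hs.of_convex (Finset.filter_subset _ _) fun i _ j hj k hk _ hkj =>
      Finset.mem_filter.2 ⟨hk, hkj.trans (Finset.mem_filter.1 hj).2⟩
  have hAsub : (s.filter fun u => u < 2 * n) ⊆ Finset.range (2 * n) := fun u hu =>
    Finset.mem_range.2 (Finset.mem_filter.1 hu).2
  have hBsub : (s.filter fun u => ¬ u < 2 * n) ⊆ Finset.Ico (2 * n) (6 * n) := fun u hu =>
    Finset.mem_Ico.2 ⟨not_lt.1 (Finset.mem_filter.1 hu).2, hlt u (Finset.mem_filter.1 hu).1⟩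
  have hAcard := Finset.card_le_card hAsub
  have hBcard := Finset.card_le_card hBsub
  rw [Finset.card_range] at hAcard
  rw [Nat.card_Ico] at hBcard
  rcases Nat.lt_or_ge (s.filter fun u => u < 2 * n).card (2 * r) with hsmall | hlarge
  · have hB := Finset.eq_of_subset_of_card_le hBsub (by rw [Nat.card_Ico]; omega)
    have hmem : ∀ u, 2 * n ≤ u → u < 6 * n → u ∈ s := fun u h₁ h₂ =>
      (Finset.mem_filter.1 (hB.symm ▸ Finset.mem_Ico.2 ⟨h₁, h₂⟩ :
        u ∈ s.filter fun u => ¬ u < 2 * n)).1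
    have hstep : ∀ u, 2 * n ≤ u → u + 2 < 6 * n → Y (u + 2) = Y u := by
      intro u h₁ h₂
      have hu₀ := hmem u h₁ (by omega)
      have hu₁ := hmem (u + 1) (by omega) (by omega)
      have hu₂ := hmem (u + 2) (by omega) (by omega)
      have n₀ := hs.1 _ hu₀
      have n₁ := hs.1 _ hu₁
      have n₂ := hs.1 _ hu₂
      have d₀ := hs.2 _ hu₀ _ hu₁ (by omega) (fun k _ => by omega)
      have d₁ := hs.2 _ hu₁ _ hu₂ (by omega) (fun k _ => by omega)
      revert n₀ n₁ n₂ d₀ d₁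
      generalize Y u = p
      generalize Y (u + 1) = q
      generalize Y (u + 2) = z
      revert p q z
      decide
    refine ⟨Y (2 * n), hs.1 _ (hmem _ le_rfl (by omega)), fun j => 2 * j, fun j => ?_,
      fun j k hjk => ?_, fun j k hjk => ?_, Or.inr fun t' => ?_⟩
    · have := j.2
      change 2 * (j : ℕ) < 2 * n
      omega
    · rw [Fin.lt_def] at hjk
      change 2 * (j : ℕ) + 1 < 2 * k
      omega
    · have h : 2 * (k : ℕ) = 2 * n - 1 := hjk.2
      omega
    · induction t' with
      | zero => intro _; rfl
      | succ t' ih =>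
        intro ht'
        rw [← ih (by omega), ← hstep (2 * n + 2 * t') (by omega) (by omega)]
        rfl
  · obtain ⟨t', ht', ht's⟩ : ∃ t' < 2 * n, 2 * n + 2 * t' ∈ s := by
      by_contra! h
      -- without a term that counts there are at most `2 * n` terms in the tail
      have hsub : (s.filter fun u => ¬ u < 2 * n) ⊆
          (Finset.range (2 * n)).image fun t => 2 * n + 2 * t + 1 := by
        intro u hu
        have hu' := Finset.mem_Ico.1 (hBsub hu)
        refine Finset.mem_image.2 ⟨(u - 2 * n) / 2, Finset.mem_range.2 (by omega), ?_⟩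
        by_contra hne
        refine h ((u - 2 * n) / 2) (by omega) ?_
        rw [show 2 * n + 2 * ((u - 2 * n) / 2) = u by omega]
        exact (Finset.mem_filter.1 hu).1
      have := (Finset.card_le_card hsub).trans Finset.card_image_le
      rw [Finset.card_range] at this
      omega
    obtain ⟨g, hg, hsep, hcyc⟩ := hA.exists_sparse
      (fun u hu => (Finset.mem_filter.1 hu).2) hlarge (hs.1 _ ht's)
    exact ⟨_, hs.1 _ ht's, g, fun j => (hg j).1, hsep, hcyc,
      Or.inl fun j => ⟨(hg j).2, t', ht', rfl⟩⟩

theorem alt_claimHypergraph_le (hm : Even m) (hnm : n ≤ m) (hr : 0 < r) (hrn : r ≤ n) :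
    (claimHypergraph m n r).alt ≤ m / 2 * (2 * (r - 1) + 4 * n) := by
  refine Hypergraph.alt_le (finite_vertexSet m n r) fun X s hsV hs hcard => ?_
  obtain ⟨i, hi, t, ht, htcard, hY⟩ := hs.exists_block hsV hcard
  obtain ⟨ε, hε, g, hg, hsep, hcyc, hclaim⟩ :=
    exists_claims_of_isAlternation hY hr hrn ht htcard
  obtain ⟨M, hM⟩ := exists_matching_of_sparse hm hnm hi hg hsep hcyc
  refine ⟨ε, by revert hε; cases ε <;> decide,
    {p | ((ofLex p).1 < m / 2 ∧ (ofLex p).2 < 6 * n) ∧ X p = ε},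
    ⟨fun p hp => hp.1, M, fun a b hab => ?_⟩, fun p hp => hp.2⟩
  obtain ⟨htrail, j, hpos⟩ := hM a b hab
  rw [htrail, hpos]
  have hj := hg j
  rcases hclaim with h | h
  · obtain ⟨h₁, t', ht', h₂⟩ := h j
    exact Or.inl ⟨⟨⟨hi, show g j < 6 * n by omega⟩, h₁⟩, t', ht',
      ⟨hi, show 2 * n + 2 * t' < 6 * n by omega⟩, h₂⟩
  · exact Or.inr fun t' ht' => ⟨⟨hi, show 2 * n + 2 * t' < 6 * n by omega⟩, h t' ht'⟩

theorem le_ncard_sub_alt (hm : Even m) (hnm : n ≤ m) (hr : 0 < r) (hrn : r ≤ n) :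
    m * (n - r + 1) ≤
      (claimHypergraph m n r).vertexSet.ncard - (claimHypergraph m n r).alt := by
  have h := alt_claimHypergraph_le hm hnm hr hrn
  rw [ncard_vertexSet]
  obtain ⟨k, rfl⟩ := hm
  rw [show (k + k) / 2 = k by omega] at *
  obtain ⟨d, rfl⟩ := Nat.exists_eq_add_of_le hrn
  obtain ⟨r, rfl⟩ := Nat.exists_eq_add_of_lt hr
  refine le_trans ?_ (Nat.sub_le_sub_left h _)
  rw [← Nat.mul_sub]
  refine (Nat.le_of_eq ?_).trans (Nat.mul_le_mul_left k (show 2 * (d + 1) ≤ _ by omega))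
  rw [show 0 + r + 1 + d - (0 + r + 1) + 1 = d + 1 by omega]
  ring

theorem mem_altermaticValues (hm : Even m) (hnm : n ≤ m) (hr : 0 < r) (hrn : r ≤ n) :
    m * (n - r + 1) ∈ ((completeBipartiteGraph (Fin m) (Fin n)).kneserGraphOf
      (matchingGraph r)).altermaticValues := by
  have hmem : (claimHypergraph m n r).vertexSet.ncard - (claimHypergraph m n r).alt ∈
      ((completeBipartiteGraph (Fin m) (Fin n)).kneserGraphOf (matchingGraph r)).altermaticValues :=
    ⟨ℕ ×ₗ ℕ, claimHypergraph m n r, finite_vertexSet m n r, empty_notMem_edgeSet hr hrn,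
      nonempty_hom hr, nonempty_hom' hm hnm hr hrn, rfl⟩
  rwa [(le_of_mem_altermaticValues (colorable hr hrn) hmem).antisymm
    (le_ncard_sub_alt hm hnm hr hrn)] at hmem

end MatchingKneser

theorem mainTheorem3 (m n r : ℕ) (hr : 0 < r) (hrn : r ≤ n) (hnm : n ≤ m) (hm : Even m) :
    let K := (completeBipartiteGraph (Fin m) (Fin n)).kneserGraphOf (SimpleGraph.matchingGraph r)
    K.chromaticNumber = ((m * (n - r + 1) : ℕ) : ℕ∞) ∧
      IsGreatest K.altermaticValues K.altermaticNumber ∧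
      K.altermaticNumber = m * (n - r + 1) := by
  intro K
  have hcol : K.Colorable (m * (n - r + 1)) := MatchingKneser.colorable hr hrn
  have hmem := MatchingKneser.mem_altermaticValues hm hnm hr hrn
  have hgreatest : IsGreatest K.altermaticValues (m * (n - r + 1)) :=
    ⟨hmem, fun k hk => SimpleGraph.le_of_mem_altermaticValues hcol hk⟩
  have hζ : K.altermaticNumber = m * (n - r + 1) := hgreatest.csSup_eq
  refine ⟨le_antisymm hcol.chromaticNumber_le ?_, hζ ▸ hgreatest, hζ⟩
  refine SimpleGraph.le_chromaticNumber_iff_colorable.2 fun C hC => ?_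
  exact_mod_cast SimpleGraph.le_of_mem_altermaticValues hC hmem
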